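/- Let $X$ be a complex Hilbert space and let $T$ be a bounded linear operator on $X$. Let $W(T)=\{(Tx,x) : x\in X,\ \|x\|=1\}$ be its numerical range and let $\Omega$ be the closure of $W(T)$ in $\mathbb{C}$. Suppose that $\Omega\subseteq\{\lambda\in\mathbb{C} : |\lambda|\le 1\}$ and that there exist constants $C>0$ and $\beta\in(0,1]$ such that $$\sup\{|\lambda^n(1-\lambda)| : \lambda\in\Omega\}\le C n^{-\beta},\qquad n\ge 1.$$ Then $T$ is power-bounded, that is, $\sup_{n\ge1}\|T^n\|<\infty$; the spectrum of $T$ satisfies $\sigma(T)\cap\{\lambda\in\mathbb{C} : |\lambda|=1\}\subseteq\{1\}$; and $$\|(e^{i\theta}I-T)^{-1}\|=O\big(|\theta|^{-1/\beta}\big),\qquad \theta\to0,\ \theta\in\mathbb{R}\setminus\{0\}.$$ -/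

import Mathlib

open scoped Topology

/-- The (Hilbert space) numerical range `W(T) = {(T x, x) : ‖x‖ = 1}`. Mathlib's inner product is
linear in the second variable, so `(T x, x)` is written `inner ℂ x (T x)`. -/
noncomputable def numericalRange {X : Type*} [NormedAddCommGroup X] [InnerProductSpace ℂ X]
    (T : X →L[ℂ] X) : Set ℂ :=
  {z : ℂ | ∃ x : X, ‖x‖ = 1 ∧ inner ℂ x (T x) = z}

/-- `T` is power-bounded: `sup_{n ≥ 1} ‖T ^ n‖ < ∞`. -/
def IsPowerBounded {X : Type*} [NormedAddCommGroup X] [NormedSpace ℂ X]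
    (T : X →L[ℂ] X) : Prop :=
  ∃ M : ℝ, ∀ n : ℕ, 1 ≤ n → ‖T ^ n‖ ≤ M

/-- The resolvent growth condition `‖R(e^{iθ}, T)‖ = O(|θ|^{-α})` as `θ → 0` (`θ` real, `θ ≠ 0`),
where `R(z, T) = (z I - T)⁻¹`. The resolvents are required to exist for all small `θ ≠ 0`. -/
def ResolventGrowth {X : Type*} [NormedAddCommGroup X] [NormedSpace ℂ X]
    (T : X →L[ℂ] X) (α : ℝ) : Prop :=
  (∀ᶠ θ : ℝ in 𝓝[≠] 0, Complex.exp (θ * Complex.I) ∈ resolventSet ℂ T) ∧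
  (fun θ : ℝ => ‖resolvent T (Complex.exp (θ * Complex.I))‖)
    =O[𝓝[≠] (0 : ℝ)] (fun θ : ℝ => |θ| ^ (-α))

/-!
The numerical range controls both the powers and the resolvent of an operator on a Hilbert space.

*Powers.* The hypothesis says in particular that the numerical radius of `T` is at most `1`.
Berger's power inequality `norm_inner_pow_apply_le` passes this bound on to every power of `T`.
It follows from a computation with roots of unity: if `ω` is a primitive `n`-th root of unity and
`y k = ∑_{m < n} (ω ^ k z T) ^ m x`, then `(1 - ω ^ k z T) y k = (1 - z ^ n T ^ n) x` for every `k`,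
while the average of the `y k` is `x`. Hence `⟨x, (1 - z ^ n T ^ n) x⟩` is the average of the
numbers `⟨y k, (1 - ω ^ k z T) y k⟩`, whose real parts are nonnegative when `‖z‖ ≤ 1`. By
polarization, an operator of numerical radius at most `1` has norm at most `2`, so `‖T ^ n‖ ≤ 2`.

*Resolvent.* If `z` has distance at least `d > 0` from the numerical range, then
`d ‖x‖ ^ 2 ≤ ‖⟨x, (z - T) x⟩‖`, so `z - T` is invertible with inverse of norm at most `d⁻¹`
(`isUnit_and_norm_resolvent_le`). Both remaining claims are thus about the closure `Ω` of the
numerical range. A unimodular point `z` of `Ω` satisfies `‖1 - z‖ ≤ C n ^ (-β)` for all `n`, so it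
is `1`. For the growth rate, let `z ∈ Ω` be at distance `δ` from a unimodular `u` at distance at
least `2a` from `1`, where `a ≤ 1`. Either `δ ≥ a`, which suffices because `a ≥ a ^ (1 / β)` for
`β ≤ 1`, or `‖1 - z‖ ≥ a` and `‖z‖ ≥ 1 - δ`, and then
`(1 - n δ) a ≤ ‖z ^ n (1 - z)‖ ≤ C n ^ (-β)`; choosing `n` of size about `(2C / a) ^ (1 / β)` forces
`δ` to be at least a constant times `a ^ (1 / β)` (`rpow_le_norm_sub_of_decay`).
-/

section NumericalRadius

/-! ### Numerical radius and powers -/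

variable {X : Type*} [NormedAddCommGroup X] [InnerProductSpace ℂ X]

theorem inner_apply_eq_norm_sq_mul (T : X →L[ℂ] X) {x : X} (hx : x ≠ 0) :
    ∃ w ∈ numericalRange T, inner ℂ x (T x) = (‖x‖ : ℂ) ^ 2 * w := by
  have hx' : (‖x‖ : ℂ) ≠ 0 := by simpa using hx
  refine ⟨_, ⟨((‖x‖ : ℂ)⁻¹) • x, ?_, rfl⟩, ?_⟩
  · rw [norm_smul]
    simp [hx]
  · rw [map_smul, inner_smul_left, inner_smul_right, map_inv₀, Complex.conj_ofReal]
    field_simp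

theorem norm_inner_apply_le (T : X →L[ℂ] X)
    (hT : numericalRange T ⊆ Metric.closedBall (0 : ℂ) 1) (x : X) :
    ‖inner ℂ x (T x)‖ ≤ ‖x‖ ^ 2 := by
  rcases eq_or_ne x 0 with rfl | hx
  · simp
  obtain ⟨w, hw, h⟩ := inner_apply_eq_norm_sq_mul T hx
  have hw1 : ‖w‖ ≤ 1 := by simpa using hT hw
  rw [h, norm_mul, norm_pow, Complex.norm_real, norm_norm]
  exact mul_le_of_le_one_right (by positivity) hw1

theorem sum_pow_mul_eq_zero {ω : ℂ} {n m : ℕ} (hω : IsPrimitiveRoot ω n) (hm : m ≠ 0)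
    (hmn : m < n) : ∑ k ∈ Finset.range n, (ω ^ k) ^ m = 0 := by
  have h1 : ω ^ m ≠ 1 := hω.pow_ne_one_of_pos_of_lt hm hmn
  have h2 : (ω ^ m) ^ n = 1 := by rw [← pow_mul, mul_comm, pow_mul, hω.pow_eq_one, one_pow]
  have h3 := geom_sum_eq h1 n
  rw [h2, sub_self, zero_div] at h3
  rw [← h3]
  exact Finset.sum_congr rfl fun k _ => by rw [← pow_mul, ← pow_mul, mul_comm]

/-- Averaging the geometric sums of `ω ^ k • T` over the `n`-th roots of unity leaves only the
constant term. -/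
theorem sum_geom_sum_rootsOfUnity {ω : ℂ} {n : ℕ} (hn : n ≠ 0) (hω : IsPrimitiveRoot ω n)
    (T : X →L[ℂ] X) :
    ∑ k ∈ Finset.range n, ∑ m ∈ Finset.range n, (ω ^ k • T) ^ m = (n : ℂ) • 1 := by
  rw [Finset.sum_comm, Finset.sum_eq_single_of_mem 0 (by simpa using Nat.pos_of_ne_zero hn)]
  · simp [Nat.cast_smul_eq_nsmul]
  · intro m hm hm0
    simp_rw [smul_pow]
    rw [← Finset.sum_smul, sum_pow_mul_eq_zero hω hm0 (Finset.mem_range.mp hm), zero_smul]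

theorem re_inner_one_sub_nonneg (T : X →L[ℂ] X) (hT : ∀ x, ‖inner ℂ x (T x)‖ ≤ ‖x‖ ^ 2)
    (x : X) : 0 ≤ (inner ℂ x ((1 - T) x)).re := by
  have h : inner ℂ x ((1 - T) x) = (‖x‖ : ℂ) ^ 2 - inner ℂ x (T x) := by
    rw [sub_apply, inner_sub_right, one_apply_eq_self, inner_self_eq_norm_sq_to_K]
    rfl
  rw [h, Complex.sub_re, ← Complex.ofReal_pow, Complex.ofReal_re, sub_nonneg]
  exact (Complex.re_le_norm _).trans (hT x)

theorem re_inner_one_sub_pow_nonneg (T : X →L[ℂ] X) (hT : ∀ x, ‖inner ℂ x (T x)‖ ≤ ‖x‖ ^ 2)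
    {n : ℕ} (hn : n ≠ 0) (x : X) : 0 ≤ (inner ℂ x ((1 - T ^ n) x)).re := by
  have hω := Complex.isPrimitiveRoot_exp n hn
  set ω := Complex.exp (2 * Real.pi * Complex.I / n)
  set y : ℕ → X := fun k => (∑ m ∈ Finset.range n, (ω ^ k • T) ^ m) x with hy
  have hsum : ∑ k ∈ Finset.range n, y k = (n : ℂ) • x := by
    have := congrArg (fun S : X →L[ℂ] X => S x) (sum_geom_sum_rootsOfUnity hn hω T)
    simpa [hy, sum_apply] using this
  have hfactor : ∀ k, (1 - ω ^ k • T) (y k) = (1 - T ^ n) x := by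
    intro k
    have h := mul_neg_geom_sum (ω ^ k • T) n
    rw [smul_pow, ← pow_mul, mul_comm k n, pow_mul, hω.pow_eq_one, one_pow, one_smul] at h
    rw [← h]
    rfl
  have hpos : ∀ k, 0 ≤ (inner ℂ (y k) ((1 - T ^ n) x)).re := by
    intro k
    rw [← hfactor k]
    refine re_inner_one_sub_nonneg _ (fun v => ?_) _
    have hωk : ‖ω ^ k‖ = 1 := by rw [norm_pow, hω.norm'_eq_one hn, one_pow]
    rw [smul_apply, inner_smul_right, norm_mul, hωk, one_mul]
    exact hT v
  have htot : (n : ℝ) * (inner ℂ x ((1 - T ^ n) x)).re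
      = ∑ k ∈ Finset.range n, (inner ℂ (y k) ((1 - T ^ n) x)).re := by
    rw [← Complex.re_sum, ← sum_inner, hsum, inner_smul_left,
      Complex.conj_natCast, ← Complex.ofReal_natCast, Complex.re_ofReal_mul]
  have : 0 ≤ (n : ℝ) * (inner ℂ x ((1 - T ^ n) x)).re :=
    htot ▸ Finset.sum_nonneg fun k _ => hpos k
  exact nonneg_of_mul_nonneg_right this (by positivity)

/-- Berger's power inequality: the powers of an operator of numerical radius at most `1` have
numerical radius at most `1`. -/
theorem norm_inner_pow_apply_le (T : X →L[ℂ] X) (hT : ∀ x, ‖inner ℂ x (T x)‖ ≤ ‖x‖ ^ 2)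
    {n : ℕ} (hn : n ≠ 0) (x : X) : ‖inner ℂ x ((T ^ n) x)‖ ≤ ‖x‖ ^ 2 := by
  set q : ℂ := inner ℂ x ((T ^ n) x) with hq
  rcases eq_or_ne q 0 with h0 | h0
  · rw [h0, norm_zero]
    positivity
  have hq0 : (‖q‖ : ℂ) ≠ 0 := by simpa using h0
  -- The `n`-th power of the rotation `z` turns `q` into the positive number `‖q‖`.
  obtain ⟨z, hz⟩ := IsAlgClosed.exists_pow_nat_eq ((‖q‖ : ℂ) / q) (Nat.pos_of_ne_zero hn)
  have hz1 : ‖z‖ = 1 := by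
    have h : ‖z‖ ^ n = 1 := by
      rw [← norm_pow, hz, norm_div, Complex.norm_real, norm_norm, div_self (norm_ne_zero_iff.2 h0)]
    exact (pow_eq_one_iff_of_nonneg (norm_nonneg z) hn).1 h
  have h := re_inner_one_sub_pow_nonneg (z • T) (fun v => by
    rw [smul_apply, inner_smul_right, norm_mul, hz1, one_mul]
    exact hT v) hn x
  rw [sub_apply, inner_sub_right, one_apply_eq_self, smul_pow, smul_apply, inner_smul_right, hz,
    ← hq, div_mul_cancel₀ _ h0, inner_self_eq_norm_sq_to_K, Complex.sub_re, Complex.ofReal_re,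
    sub_nonneg] at h
  refine h.trans_eq ?_
  norm_cast

/-- By polarization, the norm of an operator is at most twice its numerical radius. -/
theorem opNorm_le_two (T : X →L[ℂ] X) (hT : ∀ x, ‖inner ℂ x (T x)‖ ≤ ‖x‖ ^ 2) : ‖T‖ ≤ 2 := by
  have hT' : ∀ x, ‖inner ℂ (T x) x‖ ≤ ‖x‖ ^ 2 := fun x => by
    rw [norm_inner_symm]
    exact hT x
  have key : ∀ x y : X, ‖x‖ = 1 → ‖y‖ = 1 → ‖inner ℂ (T y) x‖ ≤ 2 := by
    intro x y hx hy
    have h := inner_map_polarization (T : X →ₗ[ℂ] X) x y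
    simp only [ContinuousLinearMap.coe_coe] at h
    have h1 := parallelogram_law_with_norm ℂ x y
    have h2 := parallelogram_law_with_norm ℂ x (Complex.I • y)
    rw [norm_smul, Complex.norm_I, one_mul] at h2
    rw [hx, hy] at h1 h2
    have e1 := hT' (x + y)
    have e2 := hT' (x - y)
    have e3 := hT' (x + Complex.I • y)
    have e4 := hT' (x - Complex.I • y)
    rw [h, norm_div]
    have h4 : ‖(4 : ℂ)‖ = 4 := by norm_num
    rw [h4, div_le_iff₀ (by norm_num)]
    refine (norm_sub_le _ _).trans ?_
    refine (add_le_add_left ((norm_add_le _ _).trans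
      (add_le_add_left (norm_sub_le _ _) _)) _).trans ?_
    rw [norm_mul, norm_mul, Complex.norm_I, one_mul, one_mul]
    nlinarith
  refine T.opNorm_le_of_unit_norm zero_le_two fun y hy => ?_
  rcases eq_or_ne (T y) 0 with h0 | h0
  · simp [h0]
  have hn : (‖T y‖ : ℂ) ≠ 0 := by simpa using h0
  have h := key ((‖T y‖ : ℂ)⁻¹ • T y) y (by rw [norm_smul]; simp [h0]) hy
  rw [inner_smul_right, inner_self_eq_norm_sq_to_K, norm_mul, norm_inv] at h
  simp only [Complex.coe_algebraMap, norm_pow, Complex.norm_real, norm_norm] at h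
  have h0' : ‖T y‖ ≠ 0 := norm_ne_zero_iff.2 h0
  rwa [sq, inv_mul_cancel_left₀ h0'] at h

end NumericalRadius

section Resolvent

/-! ### Resolvent bounds off the numerical range -/

variable {X : Type*} [NormedAddCommGroup X] [InnerProductSpace ℂ X] [CompleteSpace X]

/-- The resolvent at a point is bounded by the inverse distance to the numerical range. -/
theorem isUnit_and_norm_resolvent_le (T : X →L[ℂ] X) (z : ℂ) {d : ℝ} (hd : 0 < d)
    (hz : ∀ w ∈ numericalRange T, d ≤ ‖w - z‖) :
    z ∈ resolventSet ℂ T ∧ ‖resolvent T z‖ ≤ d⁻¹ := by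
  set S : X →L[ℂ] X := algebraMap ℂ (X →L[ℂ] X) z - T with hS
  have hSx : ∀ x, ‖x‖ ^ 2 * d ≤ ‖inner ℂ (S x) x‖ := by
    intro x
    rcases eq_or_ne x 0 with rfl | hx
    · simp
    obtain ⟨w, hw, h⟩ := inner_apply_eq_norm_sq_mul T hx
    have e : inner ℂ x (S x) = (‖x‖ : ℂ) ^ 2 * (z - w) := by
      rw [hS, sub_apply, inner_sub_right, h, Algebra.algebraMap_eq_smul_one, smul_apply,
        one_apply_eq_self, inner_smul_right, inner_self_eq_norm_sq_to_K]
      ring_nf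
      rfl
    rw [norm_inner_symm, e, norm_mul, norm_pow, Complex.norm_real, norm_norm, norm_sub_rev]
    exact mul_le_mul_of_nonneg_left (hz w hw) (by positivity)
  have hunit : IsUnit S :=
    ContinuousLinearMap.isUnit_of_forall_le_norm_inner_map S (c := ⟨d, hd.le⟩) hd hSx
  refine ⟨hunit, ContinuousLinearMap.opNorm_le_bound _ (by positivity) fun y => ?_⟩
  have hy : S (resolvent T z y) = y := by
    have h : S * resolvent T z = 1 := Ring.mul_inverse_cancel S hunit
    exact congrArg (fun R : X →L[ℂ] X => R y) h
  set x := resolvent T z y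
  have h := (hSx x).trans (norm_inner_le_norm _ _)
  rw [hy] at h
  rcases eq_or_ne x 0 with hx | hx
  · rw [hx, norm_zero]
    positivity
  have hx' : 0 < ‖x‖ := norm_pos_iff.2 hx
  rw [inv_mul_eq_div, le_div_iff₀ hd]
  nlinarith

theorem spectrum_subset_closure_numericalRange (T : X →L[ℂ] X) :
    spectrum ℂ T ⊆ closure (numericalRange T) := by
  intro z hz
  by_contra hcl
  rw [Metric.mem_closure_iff] at hcl
  push Not at hcl
  obtain ⟨d, hd, h⟩ := hcl
  refine hz (isUnit_and_norm_resolvent_le T z hd fun w hw => ?_).1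
  rw [← dist_eq_norm, dist_comm]
  exact h w hw

end Resolvent

/-! ### Geometry of the decay condition near the unit circle -/

theorem eq_one_of_decay {C β : ℝ} (hβ₀ : 0 < β) {z : ℂ} (hz : ‖z‖ = 1)
    (h : ∀ n : ℕ, 1 ≤ n → ‖z ^ n * (1 - z)‖ ≤ C * (n : ℝ) ^ (-β)) : z = 1 := by
  have hlim : Filter.Tendsto (fun n : ℕ => C * (n : ℝ) ^ (-β)) Filter.atTop (𝓝 0) := by
    simpa using ((tendsto_rpow_neg_atTop hβ₀).comp tendsto_natCast_atTop_atTop).const_mul C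
  have hle : ‖1 - z‖ ≤ 0 := by
    refine ge_of_tendsto hlim ?_
    filter_upwards [Filter.eventually_ge_atTop 1] with n hn
    simpa [hz] using h n hn
  exact (sub_eq_zero.1 (norm_le_zero_iff.1 hle)).symm

/-- A point at which `z ^ n * (1 - z)` decays like `n ^ (-β)` keeps a distance of order
`a ^ (1 / β)` from every unimodular point at distance at least `2 * a` from `1`. -/
theorem rpow_le_norm_sub_of_decay {C β a : ℝ} (hC : 0 < C) (hβ₀ : 0 < β) (hβ₁ : β ≤ 1)
    (ha : 0 < a) (ha1 : a ≤ 1) (haC : a ≤ 2 * C) {u z : ℂ} (hu : ‖u‖ = 1) (hua : 2 * a ≤ ‖1 - u‖)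
    (h : ∀ n : ℕ, 1 ≤ n → ‖z ^ n * (1 - z)‖ ≤ C * (n : ℝ) ^ (-β)) :
    min 1 ((2 * C) ^ (-(1 / β)) / 4) * a ^ (1 / β) ≤ ‖z - u‖ := by
  have hap : 0 < a ^ (1 / β) := Real.rpow_pos_of_pos ha _
  rcases le_total a ‖z - u‖ with hδ | hδ
  · have h1 : a ^ (1 / β) ≤ a := by
      simpa using Real.rpow_le_rpow_of_exponent_ge ha ha1 ((one_le_div hβ₀).2 hβ₁)
    calc _ ≤ 1 * a ^ (1 / β) := mul_le_mul_of_nonneg_right (min_le_left _ _) hap.le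
      _ ≤ ‖z - u‖ := by linarith
  set δ := ‖z - u‖ with hδdef
  have hz1 : a ≤ ‖1 - z‖ := by
    have : ‖1 - u‖ ≤ ‖1 - z‖ + ‖z - u‖ := norm_sub_le_norm_sub_add_norm_sub _ _ _
    linarith
  have hz : 1 - δ ≤ ‖z‖ := by
    have := norm_sub_norm_le u z
    rw [norm_sub_rev, hu] at this
    linarith
  -- With `n ≥ s`, the right-hand side of the decay condition is at most `a / 2`.
  set s : ℝ := (2 * C / a) ^ (1 / β) with hs
  have hs1 : 1 ≤ s := Real.one_le_rpow ((one_le_div ha).2 haC) (by positivity)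
  set n := ⌈s⌉₊ with hn
  have hsn : s ≤ n := Nat.le_ceil s
  have hns : (n : ℝ) ≤ 2 * s := by
    have := Nat.ceil_lt_add_one (zero_le_one.trans hs1)
    linarith
  have hn1 : (1 : ℝ) ≤ n := hs1.trans hsn
  have hdecay : C * (n : ℝ) ^ (-β) ≤ a / 2 := by
    have h1 : (n : ℝ) ^ (-β) ≤ s ^ (-β) :=
      Real.rpow_le_rpow_of_nonpos (by linarith) hsn (by linarith)
    have h2 : s ^ (-β) = a / (2 * C) := by
      rw [hs, ← Real.rpow_mul (by positivity), mul_neg, one_div_mul_cancel hβ₀.ne',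
        Real.rpow_neg_one, inv_div]
    calc C * (n : ℝ) ^ (-β) ≤ C * (a / (2 * C)) := by
          rw [← h2]
          exact mul_le_mul_of_nonneg_left h1 hC.le
      _ = a / 2 := by field_simp
  have hbern : 1 - n * δ ≤ ‖z‖ ^ n := by
    have h1 : 1 + (n : ℝ) * (-δ) ≤ (1 + -δ) ^ n :=
      one_add_mul_le_pow (by linarith) n
    have h2 : (1 + -δ) ^ n ≤ ‖z‖ ^ n := pow_le_pow_left₀ (by linarith) (by linarith) n
    linarith
  have hnδ : 1 / 2 ≤ n * δ := by
    have h1 := (h n (by exact_mod_cast hn1)).trans hdecay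
    rw [norm_mul, norm_pow] at h1
    have h2 : ‖z‖ ^ n * a ≤ a / 2 := (mul_le_mul_of_nonneg_left hz1 (by positivity)).trans h1
    have h3 : ‖z‖ ^ n ≤ 1 / 2 := by
      refine le_of_mul_le_mul_right ?_ ha
      linarith
    linarith
  have hδs : 1 / (4 * s) ≤ δ := by
    rw [div_le_iff₀ (by positivity)]
    have := mul_le_mul_of_nonneg_right hns (norm_nonneg (z - u))
    linarith
  have hs' : (2 * C) ^ (-(1 / β)) / 4 * a ^ (1 / β) = 1 / (4 * s) := by
    rw [hs, Real.div_rpow (by positivity) ha.le, Real.rpow_neg (by positivity)]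
    field_simp
  calc _ ≤ (2 * C) ^ (-(1 / β)) / 4 * a ^ (1 / β) :=
        mul_le_mul_of_nonneg_right (min_le_right _ _) hap.le
    _ ≤ δ := hs' ▸ hδs

/-- Jordan's inequality for the chord from `1` to `exp (θ * I)`. -/
theorem two_mul_abs_div_pi_le_norm_one_sub_exp {θ : ℝ} (hθ : |θ| ≤ Real.pi) :
    2 * (|θ| / Real.pi) ≤ ‖1 - Complex.exp (θ * Complex.I)‖ := by
  have hj := Real.mul_abs_le_abs_sin (x := θ / 2) (by
    rw [abs_div, abs_two]
    linarith)
  rw [abs_div, abs_two] at hj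
  rw [norm_sub_rev, mul_comm (θ : ℂ), Complex.norm_exp_I_mul_ofReal_sub_one, norm_mul,
    Real.norm_eq_abs, Real.norm_eq_abs, abs_two]
  calc 2 * (|θ| / Real.pi) = 2 * (2 / Real.pi * (|θ| / 2)) := by ring
    _ ≤ _ := by linarith

/-! ### Growth of the powers and of the resolvent -/

theorem mainTheorem9 {X : Type*} [NormedAddCommGroup X] [InnerProductSpace ℂ X] [CompleteSpace X]
    (T : X →L[ℂ] X) (C β : ℝ) (hC : 0 < C) (hβ₀ : 0 < β) (hβ₁ : β ≤ 1)
    (hdisc : closure (numericalRange T) ⊆ Metric.closedBall (0 : ℂ) 1)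
    (hsup : ∀ n : ℕ, 1 ≤ n → ∀ z ∈ closure (numericalRange T),
      ‖z ^ n * (1 - z)‖ ≤ C * (n : ℝ) ^ (-β)) :
    IsPowerBounded T ∧
      spectrum ℂ T ∩ Metric.sphere (0 : ℂ) 1 ⊆ {1} ∧
      ResolventGrowth T (1 / β) := by
  refine ⟨⟨2, fun n hn => ?_⟩, ?_, ?_⟩
  · exact opNorm_le_two _ (norm_inner_pow_apply_le T
      (norm_inner_apply_le T (subset_closure.trans hdisc)) (Nat.one_le_iff_ne_zero.1 hn))
  · rintro z ⟨hz, hz1⟩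
    exact eq_one_of_decay hβ₀ (by simpa using hz1)
      fun n hn => hsup n hn z (spectrum_subset_closure_numericalRange T hz)
  set c : ℝ := min 1 ((2 * C) ^ (-(1 / β)) / 4)
  have hc : 0 < c := lt_min one_pos (by positivity)
  have hres : ∀ᶠ θ : ℝ in 𝓝[≠] 0, Complex.exp (θ * Complex.I) ∈ resolventSet ℂ T ∧
      ‖resolvent T (Complex.exp (θ * Complex.I))‖ ≤ (c * (|θ| / Real.pi) ^ (1 / β))⁻¹ := by
    have hsmall : ∀ᶠ θ : ℝ in 𝓝[≠] 0, |θ| < Real.pi * min 1 (2 * C) := by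
      refine nhdsWithin_le_nhds (continuous_abs.continuousAt.eventually_lt_const ?_)
      rw [abs_zero]
      positivity
    filter_upwards [hsmall, self_mem_nhdsWithin] with θ hθ hθ0
    have hθpos : 0 < |θ| := abs_pos.2 hθ0
    have ha : |θ| / Real.pi ≤ min 1 (2 * C) := by
      rw [div_le_iff₀' Real.pi_pos]
      exact hθ.le
    have ha1 := ha.trans (min_le_left _ _)
    refine isUnit_and_norm_resolvent_le T _ (by positivity) fun w hw => ?_
    exact rpow_le_norm_sub_of_decay hC hβ₀ hβ₁ (by positivity) ha1 (ha.trans (min_le_right _ _))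
      (Complex.norm_exp_ofReal_mul_I θ)
      (two_mul_abs_div_pi_le_norm_one_sub_exp ((div_le_one Real.pi_pos).1 ha1))
      fun n hn => hsup n hn w (subset_closure hw)
  refine ⟨hres.mono fun θ h => h.1, ?_⟩
  refine Asymptotics.IsBigO.of_bound (c⁻¹ * Real.pi ^ (1 / β)) (hres.mono fun θ h => ?_)
  rw [norm_norm, Real.norm_of_nonneg (by positivity)]
  refine h.2.trans_eq ?_
  rw [Real.div_rpow (abs_nonneg θ) Real.pi_pos.le, Real.rpow_neg (abs_nonneg θ), mul_inv, inv_div,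
    div_eq_mul_inv, mul_assoc]
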